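/- Let $\mathbf{k}$ be a commutative ring with unity. A composition is a finite list $\alpha=(\alpha_1,\ldots,\alpha_\ell)$ of positive integers; its size is $|\alpha|=\alpha_1+\cdots+\alpha_\ell$, and $D(\alpha)=\{\alpha_1,\alpha_1+\alpha_2,\ldots,\alpha_1+\cdots+\alpha_{\ell-1}\}$ is its set of partial sums. Let $\operatorname{Comp}$ be the set of all compositions. For $\alpha\in\operatorname{Comp}$ with $|\alpha|=n$, let $\omega(\alpha)$ be the unique composition $\beta$ of size $n$ with $D(\beta)=\{1,2,\ldots,n-1\}\setminus D(\alpha_\ell,\alpha_{\ell-1},\ldots,\alpha_1)$. Let $\operatorname{QSym}$ be the $\mathbf{k}$-algebra of quasisymmetric functions over $\mathbf{k}$, that is, of the bounded-degree power series in $x_1,x_2,x_3,\ldots$ in which $x_{i_1}^{\alpha_1}\cdots x_{i_\ell}^{\alpha_\ell}$ and $x_{j_1}^{\alpha_1}\cdots x_{j_\ell}^{\alpha_\ell}$ have equal coefficients whenever $(\alpha_1,\ldots,\alpha_\ell)\in\operatorname{Comp}$, $i_1<\cdots<i_\ell$ and $j_1<\cdots<j_\ell$. It has the monomial basis $M_\alpha=\sum_{i_1<\cdots<i_\ell}x_{i_1}^{\alpha_1}\cdots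 x_{i_\ell}^{\alpha_\ell}$ and the fundamental basis \[ F_\alpha=\sum_{\substack{i_1\le i_2\le\cdots\le i_n;\\ i_j<i_{j+1}\text{ if }j\in D(\alpha)}}x_{i_1}x_{i_2}\cdots x_{i_n}\qquad(n=|\alpha|), \] both indexed by $\alpha\in\operatorname{Comp}$. Its comultiplication is given by $\Delta(M_\alpha)=\sum_{i=0}^{\ell}M_{(\alpha_1,\ldots,\alpha_i)}\otimes M_{(\alpha_{i+1},\ldots,\alpha_\ell)}$, and its counit $\varepsilon:\operatorname{QSym}\to\mathbf{k}$ by $\varepsilon(M_\varnothing)=1$ and $\varepsilon(M_\alpha)=0$ for $\alpha\ne\varnothing$. Let $\operatorname{NSym}$ be the algebra of noncommutative symmetric functions over $\mathbf{k}$, that is, the free associative $\mathbf{k}$-algebra on generators $H_1,H_2,H_3,\ldots$. Let $(\cdot,\cdot):\operatorname{NSym}\times\operatorname{QSym}\to\mathbf{k}$ be the pairing with $(H_{\alpha_1}H_{\alpha_2}\cdots H_{\alpha_\ell},M_\beta)=\delta_{\alpha,\beta}$, under which the multiplication of $\operatorname{NSym}$ is dual to $\Delta$. Let $(R_\alpha)_{\alpha\in\operatorname{Comp}}$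 be the ribbon basis of $\operatorname{NSym}$, that is, the basis dual to $(F_\alpha)_{\alpha\in\operatorname{Comp}}$. For $g\in\operatorname{NSym}$, let $g^\perp:\operatorname{QSym}\to\operatorname{QSym}$ be the adjoint of the left multiplication by $g$, so that $(a,g^\perp c)=(ga,c)$ for all $a\in\operatorname{NSym}$ and $c\in\operatorname{QSym}$. Let $f\in\operatorname{QSym}$. Then $R_{\omega(\alpha)}^\perp f=0$ for all but finitely many $\alpha\in\operatorname{Comp}$, and \[ \varepsilon(f)=\sum_{\alpha\in\operatorname{Comp}}(-1)^{|\alpha|}F_\alpha\,R_{\omega(\alpha)}^\perp f , \] where $F_\alpha\,R_{\omega(\alpha)}^\perp f$ is the product of $F_\alpha$ and $R_{\omega(\alpha)}^\perp f$ in $\operatorname{QSym}$, and $\varepsilon(f)\in\mathbf{k}$ is regarded as a constant element of $\operatorname{QSym}$. -/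

import Mathlib

namespace QuasiSym

/-- A composition is a finite list of positive integers. -/
abbrev Comp : Type := List ℕ+

/-- The size `|α|` of a composition. -/
def size (α : Comp) : ℕ := (α.map (fun a : ℕ+ => (a : ℕ))).sum

/-- The set of partial sums `D(α) = {α₁, α₁ + α₂, …, α₁ + ⋯ + α_{ℓ-1}}`. -/
def partialSums (α : Comp) : Finset ℕ :=
  (Finset.Ioo 0 α.length).image (fun i => size (α.take i))

@[simp] lemma size_nil : size [] = 0 := rfl

@[simp] lemma size_append (α β : Comp) : size (α ++ β) = size α + size β := by
  simp [size]

@[simp] lemma size_cons (a : ℕ+) (β : Comp) : size (a :: β) = a + size β := by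
  simp [size]

@[simp] lemma size_reverse (α : Comp) : size α.reverse = size α := by
  simp [size, List.sum_reverse]

lemma size_eq_zero {α : Comp} : size α = 0 ↔ α = [] := by
  cases α with
  | nil => simp
  | cons a α => simp

@[simp] lemma partialSums_nil : partialSums [] = ∅ := rfl

@[simp] lemma partialSums_singleton (a : ℕ+) : partialSums [a] = ∅ := rfl

lemma partialSums_concat {α : Comp} (h : α ≠ []) (a : ℕ+) :
    partialSums (α ++ [a]) = insert (size α) (partialSums α) := by
  have hl : 0 < α.length := List.length_pos_iff.mpr h
  ext x
  simp only [partialSums, Finset.mem_image, Finset.mem_Ioo, Finset.mem_insert, List.length_append,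
    List.length_singleton]
  constructor
  · rintro ⟨i, ⟨h0, h1⟩, rfl⟩
    rcases Nat.lt_or_ge i α.length with h2 | h2
    · right
      exact ⟨i, ⟨h0, h2⟩, by rw [List.take_append_of_le_length h2.le]⟩
    · left
      obtain rfl : i = α.length := by omega
      simp
  · rintro (rfl | ⟨i, ⟨h0, h1⟩, rfl⟩)
    · exact ⟨α.length, ⟨hl, by omega⟩, by simp⟩
    · exact ⟨i, ⟨h0, by omega⟩, by rw [List.take_append_of_le_length h1.le]⟩

lemma partialSums_subset (α : Comp) : partialSums α ⊆ Finset.Ioo 0 (size α) := by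
  induction α using List.reverseRecOn with
  | nil => simp
  | append_singleton α a ih =>
    by_cases h : α = []
    · subst h; simp
    · rw [partialSums_concat h]
      intro x hx
      have hs : size α ≠ 0 := fun h' => h (size_eq_zero.mp h')
      have ha := a.pos
      rw [Finset.mem_insert] at hx
      simp only [size_append, size_cons, size_nil, Finset.mem_Ioo]
      rcases hx with rfl | hx
      · omega
      · have := Finset.mem_Ioo.mp (ih hx); omega

lemma partialSums_concat_eq_empty {α : Comp} {a : ℕ+} (h : partialSums (α ++ [a]) = ∅) :
    α = [] := by
  by_contra h'
  rw [partialSums_concat h'] at h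
  simp at h

lemma le_size_of_mem_concat {α : Comp} {a : ℕ+} {x : ℕ} (hx : x ∈ partialSums (α ++ [a])) :
    x ≤ size α := by
  by_cases h : α = []
  · subst h; simp at hx
  · rw [partialSums_concat h, Finset.mem_insert] at hx
    rcases hx with rfl | hx
    · exact le_rfl
    · exact (Finset.mem_Ioo.mp (partialSums_subset α hx)).2.le

lemma size_notMem (α : Comp) : size α ∉ partialSums α := fun h =>
  absurd (Finset.mem_Ioo.mp (partialSums_subset α h)).2 (lt_irrefl _)

/-- A composition is determined by its size and its set of partial sums. -/
lemma comp_ext {α β : Comp} (hs : size α = size β) (hD : partialSums α = partialSums β) :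
    α = β := by
  induction α using List.reverseRecOn generalizing β with
  | nil => exact (size_eq_zero.mp hs.symm).symm
  | append_singleton α a ih =>
    rcases List.eq_nil_or_concat β with rfl | ⟨β, b, rfl⟩
    · simp at hs
    rw [List.concat_eq_append] at *
    by_cases hα : α = []
    · subst hα
      have : β = [] := partialSums_concat_eq_empty (a := b) (by rw [← hD]; rfl)
      subst this
      simp only [List.nil_append, size_cons, size_nil, add_zero] at hs ⊢
      rw [PNat.coe_inj.mp hs]
    · have hβ : β ≠ [] := by
        rintro rfl
        exact hα (partialSums_concat_eq_empty (a := a) hD)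
      have h1 : size α = size β := by
        apply le_antisymm
        · apply le_size_of_mem_concat (a := b)
          rw [← hD, partialSums_concat hα]; simp
        · apply le_size_of_mem_concat (a := a)
          rw [hD, partialSums_concat hβ]; simp
      have h2 : partialSums α = partialSums β := by
        rw [partialSums_concat hα, partialSums_concat hβ, ← h1] at hD
        have := congrArg (fun s => s.erase (size α)) hD
        simpa [Finset.erase_insert, size_notMem, h1 ▸ size_notMem β] using this
      obtain rfl := ih h1 h2
      simp only [size_append, size_cons, size_nil, add_zero] at hs
      rw [PNat.coe_inj.mp (Nat.add_left_cancel hs)]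

lemma exists_comp (n : ℕ) (T : Finset ℕ) (hT : T ⊆ Finset.Ioo 0 n) :
    ∃ α : Comp, size α = n ∧ partialSums α = T := by
  induction n using Nat.strong_induction_on generalizing T with
  | _ n ih =>
    rcases T.eq_empty_or_nonempty with rfl | hne
    · rcases Nat.eq_zero_or_pos n with rfl | hn
      · exact ⟨[], rfl, rfl⟩
      · exact ⟨[Nat.toPNat n hn], by rw [size_cons, size_nil]; rfl, rfl⟩
    · have hm := T.max'_mem hne
      have hm' := Finset.mem_Ioo.mp (hT hm)
      obtain ⟨α, h1, h2⟩ := ih (T.max' hne) hm'.2 (T.erase (T.max' hne)) (by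
        intro x hx
        have hx' := Finset.mem_erase.mp hx
        exact Finset.mem_Ioo.mpr ⟨(Finset.mem_Ioo.mp (hT hx'.2)).1,
          lt_of_le_of_ne (T.le_max' x hx'.2) hx'.1⟩)
      have hα : α ≠ [] := by
        rintro rfl
        simp only [size_nil] at h1
        omega
      refine ⟨α ++ [Nat.toPNat (n - T.max' hne) (by omega)], ?_, ?_⟩
      · have : ((Nat.toPNat (n - T.max' hne) (by omega) : ℕ+) : ℕ) = n - T.max' hne := rfl
        rw [size_append, h1, size_cons, size_nil, this]
        omega
      · rw [partialSums_concat hα, h1, h2, Finset.insert_erase hm]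

/-- For `T ⊆ {1, …, n-1}`, there is a unique composition `β` of `n` with `D(β) = T`. -/
theorem existsUnique_comp (n : ℕ) (T : Finset ℕ) (hT : T ⊆ Finset.Ioo 0 n) :
    ∃! β : Comp, size β = n ∧ partialSums β = T := by
  obtain ⟨α, h⟩ := exists_comp n T hT
  exact ⟨α, h, fun β hβ => comp_ext (hβ.1.trans h.1.symm) (hβ.2.trans h.2.symm)⟩

lemma existsUnique_omega (α : Comp) : ∃! β : Comp, size β = size α ∧
    partialSums β = Finset.Ioo 0 (size α) \ partialSums α.reverse :=
  existsUnique_comp _ _ Finset.sdiff_subset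

/-- `ω(α)`: the unique composition `β` of `n = |α|` such that
`D(β) = {1, …, n-1} \ D(rev α)`. -/
noncomputable def omega (α : Comp) : Comp := (existsUnique_omega α).choose

theorem omega_spec (α : Comp) : size (omega α) = size α ∧
    partialSums (omega α) = Finset.Ioo 0 (size α) \ partialSums α.reverse :=
  (existsUnique_omega α).choose_spec.1

/-- There are only finitely many compositions of size at most `n`. -/
theorem finite_size_le (n : ℕ) : {α : Comp | size α ≤ n}.Finite := by
  apply Set.Finite.of_finite_image (f := fun α : Comp => (size α, partialSums α))
  · apply ((Finset.range (n + 1)) ×ˢ (Finset.range (n + 1)).powerset).finite_toSet.subset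
    rintro _ ⟨α, hα, rfl⟩
    simp only [Set.mem_ofPred_eq] at hα
    simp only [Finset.coe_product, Set.mem_prod, Finset.mem_coe, Finset.mem_range,
      Finset.mem_powerset]
    refine ⟨by omega, fun x hx => ?_⟩
    have := Finset.mem_Ioo.mp (partialSums_subset α hx)
    simp only [Finset.mem_range]; omega
  · intro α _ β _ h
    exact comp_ext (congrArg Prod.fst h) (congrArg Prod.snd h)

theorem finite_size_eq (n : ℕ) : {α : Comp | size α = n}.Finite :=
  (finite_size_le n).subset fun _ h => le_of_eq h

/-- The finite set of all compositions of `n`. -/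
noncomputable def compsOfSize (n : ℕ) : Finset Comp := (finite_size_eq n).toFinset

@[simp] lemma mem_compsOfSize {n : ℕ} {α : Comp} : α ∈ compsOfSize n ↔ size α = n := by
  simp [compsOfSize]

/-- The monomial `x_{i₁}^{α₁} x_{i₂}^{α₂} ⋯ x_{i_ℓ}^{α_ℓ}`, as an exponent vector. The
indeterminates are indexed by `ℕ`. -/
noncomputable def mon (α : Comp) (i : Fin α.length → ℕ) : ℕ →₀ ℕ :=
  ∑ j, Finsupp.single (i j) (α.get j : ℕ)

/-- Pack-equivalence of monomials: the same exponents, read in increasing order of the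
indeterminates. -/
def PackEquiv (m n : ℕ →₀ ℕ) : Prop :=
  ∃ (α : Comp) (i j : Fin α.length → ℕ), StrictMono i ∧ StrictMono j ∧ m = mon α i ∧ n = mon α j

/-- The composition formed by the nonzero exponents of a monomial, read in increasing order of the
indeterminates. -/
noncomputable def pack (m : ℕ →₀ ℕ) : Comp :=
  (m.support.sort (· ≤ ·)).map (fun i => (m i).toPNat')

lemma mon_apply (α : Comp) {i : Fin α.length → ℕ} (hi : StrictMono i) (j : Fin α.length) :
    mon α i (i j) = α.get j := by
  rw [mon, Finsupp.finsetSum_apply, Finset.sum_eq_single j]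
  · simp
  · intro b _ hb
    rw [Finsupp.single_eq_of_ne]
    exact fun h => hb (hi.injective h.symm)
  · simp

lemma mon_support (α : Comp) {i : Fin α.length → ℕ} (hi : StrictMono i) :
    (mon α i).support = Finset.univ.image i := by
  ext x
  rw [Finsupp.mem_support_iff]
  constructor
  · intro h
    by_contra hx
    apply h
    rw [mon, Finsupp.finsetSum_apply, Finset.sum_eq_zero]
    intro j _
    rw [Finsupp.single_eq_of_ne]
    rintro rfl
    exact hx (by simp)
  · intro h
    obtain ⟨j, -, rfl⟩ := Finset.mem_image.mp h
    rw [mon_apply α hi]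
    exact (α.get j).ne_zero

lemma sort_mon_support (α : Comp) {i : Fin α.length → ℕ} (hi : StrictMono i) :
    (mon α i).support.sort (· ≤ ·) = List.ofFn i := by
  have h1 : (mon α i).support = (List.ofFn i).toFinset := by
    rw [mon_support α hi]; ext; simp [List.mem_ofFn]
  rw [h1, List.toFinset_sort _ (List.nodup_ofFn.mpr hi.injective)]
  exact List.pairwise_ofFn.mpr fun a b h => (hi h).le

lemma pack_mon (α : Comp) {i : Fin α.length → ℕ} (hi : StrictMono i) : pack (mon α i) = α := by
  rw [pack, sort_mon_support α hi, List.map_ofFn]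
  have : ((fun k => (mon α i k).toPNat') ∘ i) = α.get := by
    funext j
    simp only [Function.comp_apply, mon_apply α hi]
    exact PNat.coe_toPNat' _
  rw [this, List.ofFn_get]

lemma mon_injective (α : Comp) {i j : Fin α.length → ℕ} (hi : StrictMono i) (hj : StrictMono j)
    (h : mon α i = mon α j) : i = j := by
  apply List.ofFn_injective
  rw [← sort_mon_support α hi, ← sort_mon_support α hj, h]

lemma exists_mon (m : ℕ →₀ ℕ) :
    ∃ i : Fin (pack m).length → ℕ, StrictMono i ∧ m = mon (pack m) i := by
  have hl : m.support.card = (pack m).length := by simp [pack]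
  refine ⟨m.support.orderEmbOfFin hl, (m.support.orderEmbOfFin hl).strictMono, ?_⟩
  have hget : ∀ j, ((pack m).get j : ℕ) = m (m.support.orderEmbOfFin hl j) := by
    intro j
    have h0 : m (m.support.orderEmbOfFin hl j) ≠ 0 :=
      Finsupp.mem_support_iff.mp (Finset.orderEmbOfFin_mem _ hl j)
    have : (pack m).get j = (m (m.support.orderEmbOfFin hl j)).toPNat' := by
      rw [List.get_eq_getElem]
      simp only [pack, List.getElem_map]
      rfl
    rw [this, Nat.toPNat'_coe, if_pos (Nat.pos_of_ne_zero h0)]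
  rw [mon]
  simp_rw [hget]
  ext x
  have hr := Finset.image_orderEmbOfFin_univ m.support hl
  rw [← Finset.sum_image (f := fun y => Finsupp.single y (m y))
    (fun a _ b _ h => (m.support.orderEmbOfFin hl).injective h), hr]
  exact congrArg (fun f => f x) m.sum_single.symm

/-- The monomial `x₀^{α₁} x₁^{α₂} ⋯ x_{ℓ-1}^{α_ℓ}`. -/
noncomputable def packed (α : Comp) : ℕ →₀ ℕ := mon α (fun j => (j : ℕ))

@[simp] lemma pack_packed (α : Comp) : pack (packed α) = α := pack_mon α fun _ _ h => h

lemma packEquiv_iff {m n : ℕ →₀ ℕ} : PackEquiv m n ↔ pack m = pack n := by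
  constructor
  · rintro ⟨α, i, j, hi, hj, rfl, rfl⟩
    rw [pack_mon α hi, pack_mon α hj]
  · intro h
    obtain ⟨i, hi, hm⟩ := exists_mon m
    have hn := exists_mon n
    rw [← h] at hn
    obtain ⟨j, hj, hn⟩ := hn
    exact ⟨pack m, i, j, hi, hj, hm, hn⟩

lemma mapDomain_mon (α : Comp) (i : Fin α.length → ℕ) (φ : ℕ → ℕ) :
    (mon α i).mapDomain φ = mon α (φ ∘ i) := by
  simp [mon, Finsupp.mapDomain_finsetSum, Finsupp.mapDomain_single]

lemma pack_mapDomain (m : ℕ →₀ ℕ) {φ : ℕ → ℕ} (hφ : StrictMono φ) :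
    pack (m.mapDomain φ) = pack m := by
  obtain ⟨i, hi, hm⟩ := exists_mon m
  conv_lhs => rw [hm, mapDomain_mon]
  exact pack_mon _ (hφ.comp hi)

/-- Every monomial is a strictly increasing relabelling of the packed one. -/
lemma exists_mapDomain_packed (m : ℕ →₀ ℕ) :
    ∃ φ : ℕ → ℕ, StrictMono φ ∧ m = (packed (pack m)).mapDomain φ := by
  obtain ⟨i, hi, hm⟩ := exists_mon m
  generalize pack m = α at i hi hm
  refine ⟨fun k => if h : k < α.length then i ⟨k, h⟩ else k + ∑ j, i j + 1, ?_, ?_⟩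
  · intro a b hab
    have hle : ∀ j, i j ≤ ∑ j, i j := fun j =>
      Finset.single_le_sum (f := i) (fun _ _ => Nat.zero_le _) (Finset.mem_univ j)
    by_cases hb : b < α.length
    · have ha : a < α.length := hab.trans hb
      simp only [ha, hb, dif_pos]
      exact hi hab
    · by_cases ha : a < α.length
      · simp only [ha, hb, dif_pos, dif_neg, not_false_iff]
        have := hle ⟨a, ha⟩
        omega
      · simp only [ha, hb, dif_neg, not_false_iff]
        omega
  · rw [packed, mapDomain_mon, hm]
    congr 1
    funext j
    simp

section

variable {k : Type*} [CommRing k]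

/-- A power series is bounded-degree if its monomials of large degree have coefficient `0`. -/
def IsBoundedDegree (f : MvPowerSeries ℕ k) : Prop :=
  ∃ N : ℕ, ∀ m : ℕ →₀ ℕ, N < m.degree → MvPowerSeries.coeff m f = 0

/-- A power series is quasisymmetric if pack-equivalent monomials have equal coefficients. -/
def IsQuasisymmetric (f : MvPowerSeries ℕ k) : Prop :=
  ∀ m n : ℕ →₀ ℕ, PackEquiv m n → MvPowerSeries.coeff m f = MvPowerSeries.coeff n f

lemma isQuasisymmetric_iff {f : MvPowerSeries ℕ k} : IsQuasisymmetric f ↔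
    ∀ (m : ℕ →₀ ℕ) (φ : ℕ → ℕ), StrictMono φ →
      MvPowerSeries.coeff (m.mapDomain φ) f = MvPowerSeries.coeff m f := by
  constructor
  · intro h m φ hφ
    exact h _ _ (packEquiv_iff.mpr (pack_mapDomain m hφ))
  · intro h m n hmn
    rw [packEquiv_iff] at hmn
    obtain ⟨φ, hφ, hm⟩ := exists_mapDomain_packed m
    obtain ⟨ψ, hψ, hn⟩ := exists_mapDomain_packed n
    rw [hm, hn, h _ _ hφ, h _ _ hψ, hmn]

lemma IsBoundedDegree.mul {f g : MvPowerSeries ℕ k} (hf : IsBoundedDegree f)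
    (hg : IsBoundedDegree g) : IsBoundedDegree (f * g) := by
  classical
  obtain ⟨N, hN⟩ := hf
  obtain ⟨M, hM⟩ := hg
  refine ⟨N + M, fun m hm => ?_⟩
  rw [MvPowerSeries.coeff_mul]
  apply Finset.sum_eq_zero
  rintro ⟨a, b⟩ hab
  rw [Finset.HasAntidiagonal.mem_antidiagonal] at hab
  have hd : a.degree + b.degree = m.degree := by rw [← hab, map_add]
  rcases Nat.lt_or_ge N a.degree with h | h
  · simp [hN a h]
  · simp [hM b (by omega)]

lemma IsQuasisymmetric.mul {f g : MvPowerSeries ℕ k} (hf : IsQuasisymmetric f)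
    (hg : IsQuasisymmetric g) : IsQuasisymmetric (f * g) := by
  classical
  rw [isQuasisymmetric_iff] at *
  intro m φ hφ
  rw [MvPowerSeries.coeff_mul, MvPowerSeries.coeff_mul]
  symm
  apply Finset.sum_bij (fun p _ => (p.1.mapDomain φ, p.2.mapDomain φ))
  · rintro ⟨a, b⟩ hab
    rw [Finset.HasAntidiagonal.mem_antidiagonal] at hab ⊢
    rw [← hab, Finsupp.mapDomain_add]
  · rintro ⟨a, b⟩ _ ⟨c, d⟩ _ h
    have hinj := Finsupp.mapDomain_injective (M := ℕ) hφ.injective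
    exact Prod.ext (hinj (congrArg Prod.fst h)) (hinj (congrArg Prod.snd h))
  · rintro ⟨a, b⟩ hab
    rw [Finset.HasAntidiagonal.mem_antidiagonal] at hab
    have key : ∀ c d : ℕ →₀ ℕ, c + d = m.mapDomain φ → ↑c.support ⊆ Set.range φ := by
      intro c d h x hx
      by_contra hx'
      have h1 : (c + d) x = 0 := by rw [h, Finsupp.mapDomain_of_notMem_range _ _ hx']
      have h2 : c x ≠ 0 := Finsupp.mem_support_iff.mp hx
      simp only [Finsupp.add_apply] at h1
      omega
    have ha := Finsupp.mapDomain_comapDomain φ hφ.injective a (key a b hab)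
    have hb := Finsupp.mapDomain_comapDomain φ hφ.injective b (key b a (by rw [add_comm]; exact hab))
    refine ⟨(a.comapDomain φ hφ.injective.injOn, b.comapDomain φ hφ.injective.injOn), ?_, ?_⟩
    · rw [Finset.HasAntidiagonal.mem_antidiagonal]
      apply Finsupp.mapDomain_injective (M := ℕ) hφ.injective
      rw [Finsupp.mapDomain_add, ha, hb]
      exact hab
    · exact Prod.ext ha hb
  · rintro ⟨a, b⟩ _
    rw [hf a φ hφ, hg b φ hφ]

end

variable (k : Type*) [CommRing k]

/-- The `k`-algebra `QSym` of quasisymmetric functions: the bounded-degree quasisymmetric power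
series in countably many indeterminates. -/
noncomputable def QSym : Subalgebra k (MvPowerSeries ℕ k) where
  carrier := {f | IsBoundedDegree f ∧ IsQuasisymmetric f}
  mul_mem' hf hg := ⟨hf.1.mul hg.1, hf.2.mul hg.2⟩
  add_mem' := by
    rintro f g ⟨⟨N, hN⟩, hf⟩ ⟨⟨M, hM⟩, hg⟩
    refine ⟨⟨N + M, fun m hm => ?_⟩, fun m n h => ?_⟩
    · rw [map_add, hN m (by omega), hM m (by omega), add_zero]
    · rw [map_add, map_add, hf m n h, hg m n h]
  algebraMap_mem' r := by
    classical
    refine ⟨⟨0, fun m hm => ?_⟩, isQuasisymmetric_iff.mpr fun m φ hφ => ?_⟩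
    · rw [MvPowerSeries.algebraMap_apply, MvPowerSeries.coeff_C, if_neg]
      rintro rfl
      simp at hm
    · rw [MvPowerSeries.algebraMap_apply, MvPowerSeries.coeff_C, MvPowerSeries.coeff_C]
      congr 1
      have := (Finsupp.mapDomain_injective (M := ℕ) hφ.injective).eq_iff (a := m) (b := 0)
      simpa using this

section

variable {k}

lemma QSym.isBoundedDegree (f : QSym k) : IsBoundedDegree (f : MvPowerSeries ℕ k) := f.2.1

lemma QSym.isQuasisymmetric (f : QSym k) : IsQuasisymmetric (f : MvPowerSeries ℕ k) := f.2.2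

end

lemma degree_mon (α : Comp) (i : Fin α.length → ℕ) : (mon α i).degree = size α := by
  rw [mon, map_sum]
  simp only [Finsupp.degree_single]
  rw [size, ← Fin.sum_univ_getElem]
  apply Fintype.sum_equiv (finCongr (by simp))
  intro j
  simp

lemma size_pack (m : ℕ →₀ ℕ) : size (pack m) = m.degree := by
  obtain ⟨i, _, hm⟩ := exists_mon m
  conv_rhs => rw [hm, degree_mon]

lemma coeff_eq_packed (f : QSym k) (m : ℕ →₀ ℕ) :
    MvPowerSeries.coeff m (f : MvPowerSeries ℕ k) =
      MvPowerSeries.coeff (packed (pack m)) (f : MvPowerSeries ℕ k) :=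
  f.2.2 _ _ (packEquiv_iff.mpr (pack_packed _).symm)

/-- The monomial quasisymmetric function
`M_α = ∑_{i₁ < i₂ < ⋯ < i_ℓ} x_{i₁}^{α₁} x_{i₂}^{α₂} ⋯ x_{i_ℓ}^{α_ℓ}` as a power series: the
coefficient of a monomial counts the index sequences that produce it. -/
noncomputable def monomialSeries (α : Comp) : MvPowerSeries ℕ k := fun m =>
  (Nat.card {i : Fin α.length → ℕ // StrictMono i ∧ mon α i = m} : k)

lemma coeff_monomialSeries (α : Comp) (m : ℕ →₀ ℕ) :
    MvPowerSeries.coeff m (monomialSeries k α) = if pack m = α then 1 else 0 := by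
  change (Nat.card {i : Fin α.length → ℕ // StrictMono i ∧ mon α i = m} : k) = _
  split_ifs with h
  · obtain ⟨i, hi, hm⟩ := exists_mon m
    subst h
    have : Nat.card {j : Fin (pack m).length → ℕ // StrictMono j ∧ mon (pack m) j = m} = 1 := by
      rw [Nat.card_eq_one_iff_unique]
      exact ⟨⟨fun a b => Subtype.ext (mon_injective _ a.2.1 b.2.1 (a.2.2.trans b.2.2.symm))⟩,
        ⟨⟨i, hi, hm.symm⟩⟩⟩
    rw [this, Nat.cast_one]
  · have : IsEmpty {i : Fin α.length → ℕ // StrictMono i ∧ mon α i = m} :=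
      ⟨fun i => h (by rw [← i.2.2, pack_mon α i.2.1])⟩
    rw [Nat.card_of_isEmpty, Nat.cast_zero]

/-- The power series whose coefficient at a monomial `m` depends only on the composition `pack m`
through a finitely supported function. -/
noncomputable def ofCoeffs (c : Comp →₀ k) : QSym k :=
  ⟨fun m => c (pack m), by
    constructor
    · refine ⟨c.support.sup size, fun m hm => ?_⟩
      change c (pack m) = 0
      by_contra h
      have := Finset.le_sup (f := size) (Finsupp.mem_support_iff.mpr h)
      rw [size_pack] at this
      omega
    · intro m n h
      change c (pack m) = c (pack n)
      rw [packEquiv_iff.mp h]⟩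

lemma coeff_ofCoeffs (c : Comp →₀ k) (m : ℕ →₀ ℕ) :
    MvPowerSeries.coeff m (ofCoeffs k c : MvPowerSeries ℕ k) = c (pack m) := rfl

lemma finite_coeffs (f : QSym k) : (Function.support fun α : Comp =>
    MvPowerSeries.coeff (packed α) (f : MvPowerSeries ℕ k)).Finite := by
  obtain ⟨N, hN⟩ := f.2.1
  apply (finite_size_le N).subset
  intro α hα
  by_contra h
  apply hα
  apply hN
  rw [← size_pack, pack_packed]
  exact not_le.mp h

/-- `QSym` is free: a quasisymmetric function is given by its coefficients at packed monomials. -/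
noncomputable def coeffsEquiv : QSym k ≃ₗ[k] (Comp →₀ k) where
  toFun f := Finsupp.ofSupportFinite _ (finite_coeffs k f)
  map_add' f g := by ext α; simp [Finsupp.ofSupportFinite_coe]
  map_smul' r f := by ext α; simp [Finsupp.ofSupportFinite_coe]
  invFun c := ofCoeffs k c
  left_inv f := by
    apply Subtype.ext
    ext m
    rw [coeff_ofCoeffs, Finsupp.ofSupportFinite_coe, ← coeff_eq_packed]
  right_inv c := by
    ext α
    rw [Finsupp.ofSupportFinite_coe, coeff_ofCoeffs, pack_packed]

/-- The monomial basis `(M_α)` of `QSym`. -/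
noncomputable def monomialBasis : Module.Basis Comp k (QSym k) :=
  Module.Basis.ofRepr (coeffsEquiv k)

/-- The vectors of the monomial basis are the monomial quasisymmetric functions. -/
theorem coe_monomialBasis (α : Comp) :
    (monomialBasis k α : MvPowerSeries ℕ k) = monomialSeries k α := by
  ext m
  rw [coeff_monomialSeries]
  change (Finsupp.single α (1 : k)) (pack m) = _
  rw [Finsupp.single_apply]
  congr 1
  exact propext eq_comm

lemma monomialBasis_repr (f : QSym k) (α : Comp) : (monomialBasis k).repr f α =
    MvPowerSeries.coeff (packed α) (f : MvPowerSeries ℕ k) := rfl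

/-- The counit `ε` of `QSym`: `ε(M_∅) = 1`, and `ε(M_α) = 0` for `α ≠ ∅`. -/
noncomputable def counit : QSym k →ₗ[k] k :=
  (monomialBasis k).constr k fun α => if α = [] then 1 else 0

open scoped TensorProduct in
/-- The comultiplication `Δ` of `QSym`: `Δ(M_α) = ∑_{i=0}^{ℓ} M_{(α₁,…,α_i)} ⊗ M_{(α_{i+1},…,α_ℓ)}`. -/
noncomputable def comul : QSym k →ₗ[k] QSym k ⊗[k] QSym k :=
  (monomialBasis k).constr k fun α => ∑ i ∈ Finset.range (α.length + 1),
    monomialBasis k (α.take i) ⊗ₜ[k] monomialBasis k (α.drop i)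

/-- The algebra `NSym` of noncommutative symmetric functions: the free associative algebra on
generators `H₁, H₂, H₃, …`. -/
abbrev NSym : Type _ := MonoidAlgebra k (FreeMonoid ℕ+)

/-- The complete basis: `H_α = H_{α₁} H_{α₂} ⋯ H_{α_ℓ}`. -/
noncomputable def complete (α : Comp) : NSym k := MonoidAlgebra.single (FreeMonoid.ofList α) 1

/-- The pairing `(·, ·) : NSym × QSym → k`, under which the bases `(H_α)` and `(M_α)` are dual. -/
noncomputable def pairing : NSym k →ₗ[k] QSym k →ₗ[k] k :=
  (MonoidAlgebra.basis (FreeMonoid ℕ+) k).constr k fun w => (monomialBasis k).coord w.toList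

theorem pairing_complete_monomial (α β : Comp) :
    pairing k (complete k α) (monomialBasis k β) = if α = β then 1 else 0 := by
  rw [complete, ← MonoidAlgebra.basis_apply, pairing, Module.Basis.constr_basis]
  simp [Module.Basis.coord_apply, Finsupp.single_apply, eq_comm]

lemma complete_mul (α β : Comp) : complete k α * complete k β = complete k (α ++ β) := by
  simp [complete, MonoidAlgebra.single_mul_single]

lemma pairing_complete (α : Comp) (f : QSym k) :
    pairing k (complete k α) f = (monomialBasis k).repr f α := by
  rw [complete, ← MonoidAlgebra.basis_apply, pairing, Module.Basis.constr_basis]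
  rfl

lemma nsym_ext {V : Type*} [AddCommMonoid V] [Module k V] {f g : NSym k →ₗ[k] V}
    (h : ∀ α, f (complete k α) = g (complete k α)) : f = g :=
  (MonoidAlgebra.basis (FreeMonoid ℕ+) k).ext fun w => by
    rw [MonoidAlgebra.basis_apply]; exact h w.toList

/-- The product of `NSym` is dual to the coproduct of `QSym`. -/
theorem pairing_mul (a b : NSym k) (c : QSym k) : pairing k (a * b) c =
    LinearMap.mul' k k (TensorProduct.map (pairing k a) (pairing k b) (comul k c)) := by
  let L : NSym k →ₗ[k] NSym k →ₗ[k] QSym k →ₗ[k] k := (LinearMap.mul k (NSym k)).compr₂ (pairing k)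
  let R : NSym k →ₗ[k] NSym k →ₗ[k] QSym k →ₗ[k] k :=
    LinearMap.mk₂ k (fun a b => LinearMap.mul' k k ∘ₗ
        TensorProduct.map (pairing k a) (pairing k b) ∘ₗ comul k)
      (fun a a' b => by ext; simp [TensorProduct.map_add_left])
      (fun r a b => by ext; simp [TensorProduct.map_smul_left])
      (fun a b b' => by ext; simp [TensorProduct.map_add_right])
      (fun r a b => by ext; simp [TensorProduct.map_smul_right])
  have hLR : L = R := by
    apply nsym_ext; intro α
    apply nsym_ext; intro β
    apply (monomialBasis k).ext; intro γ
    change pairing k (complete k α * complete k β) (monomialBasis k γ) =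
      LinearMap.mul' k k (TensorProduct.map (pairing k (complete k α)) (pairing k (complete k β))
        (comul k (monomialBasis k γ)))
    rw [complete_mul, pairing_complete_monomial, comul, Module.Basis.constr_basis]
    simp only [map_sum, TensorProduct.map_tmul, LinearMap.mul'_apply, pairing_complete_monomial]
    split_ifs with h
    · subst h
      rw [Finset.sum_eq_single α.length]
      · simp
      · intro i hi hne
        rw [if_neg, zero_mul]
        intro h
        apply hne
        have := congrArg List.length h
        rw [List.length_take, List.length_append] at this
        rw [Finset.mem_range, List.length_append] at hi
        omega
      · simp
    · symm
      apply Finset.sum_eq_zero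
      intro i _
      by_cases h1 : α = γ.take i
      · rw [if_neg (c := β = γ.drop i), mul_zero]
        intro h2
        exact h (by rw [h1, h2, List.take_append_drop])
      · rw [if_neg h1, zero_mul]
  exact congrArg (fun T : NSym k →ₗ[k] NSym k →ₗ[k] QSym k →ₗ[k] k => T a b c) hLR

theorem pairing_one (c : QSym k) : pairing k 1 c = counit k c := by
  have : pairing k 1 = counit k := by
    apply (monomialBasis k).ext
    intro α
    change pairing k (complete k []) _ = _
    rw [pairing_complete_monomial, counit, Module.Basis.constr_basis]
    congr 1
    exact propext eq_comm
  rw [this]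

/-- The pairing is nondegenerate on the side of `QSym`. -/
theorem eq_zero_of_pairing_left (c : QSym k) (h : ∀ a, pairing k a c = 0) : c = 0 := by
  apply (monomialBasis k).ext_elem
  intro α
  rw [← pairing_complete, h, map_zero]
  rfl

/-- The pairing is nondegenerate on the side of `NSym`. -/
theorem eq_zero_of_pairing_right (a : NSym k) (h : ∀ c, pairing k a c = 0) : a = 0 := by
  apply (MonoidAlgebra.basis (FreeMonoid ℕ+) k).ext_elem
  intro w
  have h1 := h (monomialBasis k w.toList)
  have h2 : (pairing k).flip (monomialBasis k w.toList) =
      (MonoidAlgebra.basis (FreeMonoid ℕ+) k).coord w := by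
    apply nsym_ext
    intro α
    classical
    rw [LinearMap.flip_apply, pairing_complete_monomial, Module.Basis.coord_apply, complete,
      ← MonoidAlgebra.basis_apply, Module.Basis.repr_self, Finsupp.single_apply]
    congr 1
  have h3 := congrArg (fun T : NSym k →ₗ[k] k => T a) h2
  simp only [LinearMap.flip_apply, Module.Basis.coord_apply, h1] at h3
  simp [← h3]

/-- The operator `g^⊥ : QSym → QSym`, `g^⊥ f = ∑_{(f)} (g, f_{(1)}) f_{(2)}`. By `pairing_perp` and
`perp_unique`, this is the adjoint of the left multiplication by `g` on `NSym` with respect to the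
pairing. -/
noncomputable def perp (g : NSym k) : QSym k →ₗ[k] QSym k :=
  (TensorProduct.lid k (QSym k)).toLinearMap ∘ₗ (pairing k g).rTensor (QSym k) ∘ₗ comul k

theorem pairing_perp (g a : NSym k) (c : QSym k) :
    pairing k a (perp k g c) = pairing k (g * a) c := by
  rw [pairing_mul, perp, LinearMap.comp_apply, LinearMap.comp_apply]
  induction comul k c using TensorProduct.induction_on with
  | zero => simp
  | tmul x y => simp
  | add x y hx hy => simp only [map_add, hx, hy]

theorem perp_unique (g : NSym k) (T : QSym k →ₗ[k] QSym k)
    (hT : ∀ a c, pairing k a (T c) = pairing k (g * a) c) : T = perp k g := by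
  ext1 c
  rw [← sub_eq_zero]
  apply eq_zero_of_pairing_left
  intro a
  rw [map_sub, hT, pairing_perp, sub_self]

/-- The fundamental quasisymmetric function
`F_α = ∑ x_{i₁} x_{i₂} ⋯ x_{i_n}` as a power series, where `n = |α|` and the sum ranges over all
`i₁ ≤ i₂ ≤ ⋯ ≤ i_n` such that `i_j < i_{j+1}` whenever `j ∈ D(α)`: the coefficient of a monomial
counts the index sequences that produce it. (The positions here are counted from `0`, so that the
entries `i_j`, `i_{j+1}` stand in the positions `a = j - 1`, `b = j`.) -/
noncomputable def fundamentalSeries (α : Comp) : MvPowerSeries ℕ k := fun m =>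
  (Nat.card {i : Fin (size α) → ℕ // Monotone i ∧
    (∀ a b : Fin (size α), (b : ℕ) = a + 1 → (b : ℕ) ∈ partialSums α → i a < i b) ∧
    ∑ j, Finsupp.single (i j) 1 = m} : k)

/-- The number of partial sums of `β` that are at most `j`. -/
def level (β : Comp) (j : ℕ) : ℕ := ((partialSums β).filter (· ≤ j)).card

lemma level_mono (β : Comp) : Monotone (level β) := fun _ _ h =>
  Finset.card_le_card (Finset.monotone_filter_right _ fun _ _ hx => hx.trans h)

lemma level_lt_iff (β : Comp) (j : ℕ) : level β j < level β (j + 1) ↔ j + 1 ∈ partialSums β := by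
  constructor
  · intro h
    by_contra hj
    apply h.ne
    rw [level, level]
    congr 1
    apply Finset.filter_congr
    intro x hx
    have : x ≠ j + 1 := fun h' => hj (h' ▸ hx)
    omega
  · intro h
    apply Finset.card_lt_card
    rw [Finset.ssubset_iff_of_subset
      (Finset.monotone_filter_right _ fun _ _ (hx : _ ≤ j) => hx.trans (Nat.le_succ j))]
    exact ⟨j + 1, by simp [h], by simp⟩

lemma card_partialSums_concat (α : Comp) (a : ℕ+) :
    (partialSums (α ++ [a])).card = α.length := by
  induction α using List.reverseRecOn generalizing a with
  | nil => rfl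
  | append_singleton α b ih =>
    rw [partialSums_concat (by simp), Finset.card_insert_of_notMem (size_notMem _), ih]
    simp

lemma packed_concat (β : Comp) (b : ℕ+) :
    packed (β ++ [b]) = packed β + Finsupp.single β.length (b : ℕ) := by
  have hl : (β ++ [b]).length = β.length + 1 := by simp
  rw [packed, mon, ← Fintype.sum_equiv (finCongr hl.symm)
    (fun j => Finsupp.single (j : ℕ) (((β ++ [b]).get (finCongr hl.symm j) : ℕ+) : ℕ)) _
    (fun j => rfl), Fin.sum_univ_castSucc]
  congr 1
  · rw [packed, mon]
    apply Finset.sum_congr rfl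
    intro j _
    simp
  · simp

lemma sum_level (β : Comp) :
    ∑ j ∈ Finset.range (size β), Finsupp.single (level β j) 1 = packed β := by
  induction β using List.reverseRecOn with
  | nil => simp [packed, mon]
  | append_singleton β b ih =>
    rw [packed_concat, size_append, Finset.sum_range_add, ← ih]
    congr 1
    · apply Finset.sum_congr rfl
      intro j hj
      rw [Finset.mem_range] at hj
      congr 1
      by_cases h : β = []
      · subst h; simp at hj
      · rw [level, level, partialSums_concat h, Finset.filter_insert, if_neg (by omega)]
    · have : ∀ j ∈ Finset.range (size [b]),
          Finsupp.single (level (β ++ [b]) (size β + j)) 1 = Finsupp.single β.length 1 := by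
        intro j _
        congr 1
        rw [level, Finset.filter_true_of_mem, card_partialSums_concat]
        intro x hx
        exact (le_size_of_mem_concat hx).trans (Nat.le_add_right _ _)
      rw [Finset.sum_congr rfl this]
      simp

lemma eq_of_monotone_of_sum_eq {n : ℕ} {i j : Fin n → ℕ} (hi : Monotone i) (hj : Monotone j)
    (h : ∑ a, Finsupp.single (i a) 1 = ∑ a, Finsupp.single (j a) 1) : i = j := by
  apply List.ofFn_injective
  have key : ∀ l : Fin n → ℕ, Finsupp.toMultiset (∑ a, Finsupp.single (l a) 1) =
      (List.ofFn l : Multiset ℕ) := by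
    intro l
    rw [map_sum, ← Fin.univ_val_map, ← Multiset.sum_map_singleton (Finset.univ.val.map l),
      Multiset.map_map]
    simp only [Finsupp.toMultiset_single, one_smul]
    rfl
  have hp : (List.ofFn i).Perm (List.ofFn j) := by
    rw [← Multiset.coe_eq_coe, ← key, ← key, h]
  exact hp.eq_of_pairwise' (List.pairwise_ofFn.mpr fun a b h => hi h.le)
    (List.pairwise_ofFn.mpr fun a b h => hj h.le)

lemma coeff_fundamentalSeries (α : Comp) (m : ℕ →₀ ℕ) :
    MvPowerSeries.coeff m (fundamentalSeries k α) =
      if size α = size (pack m) ∧ partialSums α ⊆ partialSums (pack m) then 1 else 0 := by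
  change (Nat.card {i : Fin (size α) → ℕ // Monotone i ∧
    (∀ a b : Fin (size α), (b : ℕ) = a + 1 → (b : ℕ) ∈ partialSums α → i a < i b) ∧
    ∑ j, Finsupp.single (i j) 1 = m} : k) = _
  obtain ⟨φ, hφ, hm⟩ := exists_mapDomain_packed m
  generalize pack m = β at hm ⊢
  let w : Fin (size α) → ℕ := fun j => φ (level β j)
  have hw : Monotone w := fun a b h => hφ.monotone (level_mono β h)
  have hsum : size α = size β → ∑ j, Finsupp.single (w j) 1 = m := by
    intro hs
    rw [hm, ← sum_level, Finsupp.mapDomain_finsetSum,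
      Fin.sum_univ_eq_sum_range (fun j => Finsupp.single (φ (level β j)) 1), hs]
    simp [Finsupp.mapDomain_single]
  split_ifs with h
  · have : Nat.card {i : Fin (size α) → ℕ // Monotone i ∧
        (∀ a b : Fin (size α), (b : ℕ) = a + 1 → (b : ℕ) ∈ partialSums α → i a < i b) ∧
        ∑ j, Finsupp.single (i j) 1 = m} = 1 := by
      rw [Nat.card_eq_one_iff_unique]
      refine ⟨⟨fun a b => Subtype.ext (eq_of_monotone_of_sum_eq a.2.1 b.2.1
        (a.2.2.2.trans b.2.2.2.symm))⟩, ⟨⟨w, hw, ?_, hsum h.1⟩⟩⟩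
      intro a b hab hb
      rw [hab] at hb
      have := (level_lt_iff β a).mpr (h.2 hb)
      change φ _ < φ _
      rw [hab]
      exact hφ this
    rw [this, Nat.cast_one]
  · have : IsEmpty {i : Fin (size α) → ℕ // Monotone i ∧
        (∀ a b : Fin (size α), (b : ℕ) = a + 1 → (b : ℕ) ∈ partialSums α → i a < i b) ∧
        ∑ j, Finsupp.single (i j) 1 = m} := by
      constructor
      rintro ⟨i, hi, hasc, hi'⟩
      have hs : size α = size β := by
        have h1 := congrArg Finsupp.degree hi'
        have h2 : m.degree = size β := by
          rw [← size_pack, hm, pack_mapDomain _ hφ, pack_packed]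
        rw [h2, map_sum] at h1
        simpa using h1
      apply h
      refine ⟨hs, fun x hx => ?_⟩
      have hiw : i = w := eq_of_monotone_of_sum_eq hi hw (hi'.trans (hsum hs).symm)
      obtain ⟨h0, h1⟩ := Finset.mem_Ioo.mp (partialSums_subset α hx)
      have h2 := hasc ⟨x - 1, by omega⟩ ⟨x, h1⟩ (by simp; omega) hx
      rw [hiw] at h2
      have h3 := hφ.lt_iff_lt.mp h2
      have h4 : x = (x - 1) + 1 := by omega
      change level β (x - 1) < level β x at h3
      rw [h4]
      rw [← level_lt_iff, ← h4]
      exact h3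
    rw [Nat.card_of_isEmpty, Nat.cast_zero]

/-- The fundamental quasisymmetric function `F_α`, as an element of `QSym`. -/
noncomputable def fundamental (α : Comp) : QSym k :=
  ⟨fundamentalSeries k α, by
    constructor
    · refine ⟨size α, fun m hm => ?_⟩
      rw [coeff_fundamentalSeries, if_neg]
      rw [size_pack]
      omega
    · intro m n h
      rw [coeff_fundamentalSeries, coeff_fundamentalSeries, packEquiv_iff.mp h]⟩

lemma monomialBasis_repr_fundamental (α β : Comp) : (monomialBasis k).repr (fundamental k α) β =
    if size α = size β ∧ partialSums α ⊆ partialSums β then 1 else 0 := by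
  rw [monomialBasis_repr]
  change MvPowerSeries.coeff _ (fundamentalSeries k α) = _
  rw [coeff_fundamentalSeries, pack_packed]

lemma fundamental_eq_sum (α : Comp) : fundamental k α =
    ∑ β ∈ (compsOfSize (size α)).filter (fun β => partialSums α ⊆ partialSums β),
      monomialBasis k β := by
  apply (monomialBasis k).ext_elem
  intro γ
  rw [monomialBasis_repr_fundamental]
  simp [Finsupp.single_apply, eq_comm]

/-- The ribbon basis `R_α = ∑_β (-1)^{|D(α) \ D(β)|} H_β` of `NSym`, where `β` ranges over the
compositions of `|α|` that are coarser than `α`, that is, `D(β) ⊆ D(α)`. By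
`pairing_ribbon_fundamental` and `ribbon_unique`, it is the dual basis to `(F_α)`. -/
noncomputable def ribbon (α : Comp) : NSym k :=
  ∑ β ∈ (compsOfSize (size α)).filter (fun β => partialSums β ⊆ partialSums α),
    (-1 : k) ^ (partialSums α \ partialSums β).card • complete k β

theorem pairing_ribbon_fundamental (α γ : Comp) :
    pairing k (ribbon k α) (fundamental k γ) = if α = γ then 1 else 0 := by
  rw [ribbon, map_sum, LinearMap.sum_apply]
  simp only [map_smul, LinearMap.smul_apply, pairing_complete, monomialBasis_repr_fundamental,
    smul_eq_mul, mul_ite, mul_one, mul_zero]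
  by_cases h : size γ = size α ∧ partialSums γ ⊆ partialSums α
  · have hc : (if α = γ then (1 : k) else 0) =
        ((∑ U ∈ (partialSums α \ partialSums γ).powerset, (-1 : ℤ) ^ U.card : ℤ) : k) := by
      rw [Finset.sum_powerset_neg_one_pow_card]
      have : α = γ ↔ partialSums α \ partialSums γ = ∅ := by
        rw [Finset.sdiff_eq_empty_iff_subset]
        exact ⟨fun e => by rw [e], fun e => comp_ext h.1.symm (e.antisymm h.2)⟩
      simp [this]
    rw [hc, ← Finset.sum_filter, Int.cast_sum]
    apply Finset.sum_bij (fun β _ => partialSums α \ partialSums β)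
    · intro β hβ
      simp only [Finset.mem_filter] at hβ
      exact Finset.mem_powerset.mpr (Finset.sdiff_subset_sdiff subset_rfl hβ.2.2)
    · intro β hβ β' hβ' e
      simp only [Finset.mem_filter, mem_compsOfSize] at hβ hβ'
      apply comp_ext (hβ.1.1.trans hβ'.1.1.symm)
      rw [← Finset.sdiff_sdiff_eq_self hβ.1.2, ← Finset.sdiff_sdiff_eq_self hβ'.1.2, e]
    · intro U hU
      rw [Finset.mem_powerset] at hU
      obtain ⟨β, hβ, hβ'⟩ := exists_comp (size α) (partialSums α \ U)
        (Finset.sdiff_subset.trans (partialSums_subset α))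
      refine ⟨β, ?_, ?_⟩
      · simp only [Finset.mem_filter, mem_compsOfSize]
        refine ⟨⟨hβ, by rw [hβ']; exact Finset.sdiff_subset⟩, h.1.trans hβ.symm, ?_⟩
        rw [hβ']
        intro x hx
        exact Finset.mem_sdiff.mpr ⟨h.2 hx, fun hxU => (Finset.mem_sdiff.mp (hU hxU)).2 hx⟩
      · rw [hβ', Finset.sdiff_sdiff_eq_self (hU.trans Finset.sdiff_subset)]
    · intro β _
      simp
  · rw [if_neg (fun e : α = γ => h ⟨by rw [e], by rw [e]⟩)]
    apply Finset.sum_eq_zero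
    intro β hβ
    simp only [Finset.mem_filter, mem_compsOfSize] at hβ
    rw [if_neg]
    exact fun h' => h ⟨h'.1.trans hβ.1, h'.2.trans hβ.2⟩

lemma eq_zero_of_pairing_fundamental (a : NSym k) (h : ∀ γ, pairing k a (fundamental k γ) = 0) :
    a = 0 := by
  have key : ∀ (n : ℕ) (β : Comp), size β - (partialSums β).card = n →
      pairing k a (monomialBasis k β) = 0 := by
    intro n
    induction n using Nat.strong_induction_on with
    | _ n ih =>
      intro β hn
      have h1 := h β
      have hmem : β ∈ (compsOfSize (size β)).filter
          (fun γ => partialSums β ⊆ partialSums γ) := by simp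
      rw [fundamental_eq_sum, ← Finset.add_sum_erase _ _ hmem, map_add, map_sum,
        Finset.sum_eq_zero, add_zero] at h1
      · exact h1
      · intro γ hγ
        simp only [Finset.mem_erase, Finset.mem_filter, mem_compsOfSize] at hγ
        apply ih (size γ - (partialSums γ).card) _ γ rfl
        have hlt : (partialSums β).card < (partialSums γ).card :=
          Finset.card_lt_card (Finset.ssubset_iff_subset_ne.mpr
            ⟨hγ.2.2, fun e => hγ.1 (comp_ext hγ.2.1 e.symm)⟩)
        have hle := Finset.card_le_card (partialSums_subset γ)
        rw [Nat.card_Ioo] at hle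
        omega
  apply eq_zero_of_pairing_right
  intro c
  have : pairing k a = 0 := (monomialBasis k).ext fun β => by
    rw [key _ β rfl, LinearMap.zero_apply]
  rw [this, LinearMap.zero_apply]

theorem ribbon_unique (α : Comp) (r : NSym k)
    (hr : ∀ γ, pairing k r (fundamental k γ) = if α = γ then 1 else 0) : r = ribbon k α := by
  rw [← sub_eq_zero]
  apply eq_zero_of_pairing_fundamental
  intro γ
  rw [map_sub, LinearMap.sub_apply, hr, pairing_ribbon_fundamental, sub_self]

end QuasiSym

/-! The formula is the antipode axiom `m ∘ (S ⊗ id) ∘ Δ = u ∘ ε` of `QSym`, with `S(F_β) =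
(-1)^{|β|} F_{ω(β)}` hidden in it. No Hopf algebra theory is used: it is checked on `f = M_γ` by a
sign cancellation.

Since `R^⊥ M_γ = ∑_i (R, M_{γ₁…γ_i}) M_{γ_{i+1}…γ_ℓ}`, exchanging the sums turns the right-hand side
into `∑_i S(M_{γ₁…γ_i}) M_{γ_{i+1}…γ_ℓ}`, where `S(M_δ) = ∑_α (-1)^{|α|} (R_{ω(α)}, M_δ) F_α` is
`antipodeMonomial`. Expanding ribbons and fundamentals leaves an alternating sum over the subsets of
`D(β) \ D(rev δ)` as the coefficient of `M_β`. Hence `S(M_δ) = (-1)^{ℓ(δ)} ∑ M_β` over `D(β) ⊆ D(rev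
δ)` (`coeff_antipodeMonomial`), which is `(-1)^{ℓ(δ)}` times the sum of `x_{l₁}^{δ₁} x_{l₂}^{δ₂} ⋯`
over weakly decreasing `l` (`exists_weaklyDecreasing_iff`).

The coefficient of a monomial in the `i`-th product therefore counts, with sign `(-1)^i`, index
lists that weakly decrease on the first `i` entries and strictly increase on the rest
(`bijOn_splitLists`). Comparing the two entries at the cut splits these lists into two classes, each
shared with a neighbouring `i`, so the signed count telescopes to `0` for `γ ≠ ∅`
(`sum_neg_one_pow_mul_ncard_splitLists`). -/

namespace QuasiSym

/-! ### Monomials of index lists. -/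

/-- The monomial `∏_j x_{l_j}^{δ_j}`, for a list `l` of indices. -/
noncomputable def listMon (δ : Comp) (l : List ℕ) : ℕ →₀ ℕ :=
  (List.zipWith (fun (a : ℕ+) (i : ℕ) => Finsupp.single i (a : ℕ)) δ l).sum

lemma listMon_append {δ ε : Comp} {l l' : List ℕ} (h : δ.length = l.length) :
    listMon (δ ++ ε) (l ++ l') = listMon δ l + listMon ε l' := by
  rw [listMon, List.zipWith_append h, List.sum_append]
  rfl

lemma listMon_reverse {δ : Comp} {l : List ℕ} (h : δ.length = l.length) :
    listMon δ.reverse l.reverse = listMon δ l := by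
  rw [listMon, ← List.reverse_zipWith h, List.sum_reverse]
  rfl

lemma listMon_ofFn (δ : Comp) (i : Fin δ.length → ℕ) : listMon δ (List.ofFn i) = mon δ i := by
  have : List.zipWith (fun (a : ℕ+) (i : ℕ) => Finsupp.single i (a : ℕ)) δ (List.ofFn i) =
      List.ofFn fun j => Finsupp.single (i j) (δ.get j : ℕ) := by
    apply List.ext_getElem <;> simp
  rw [listMon, this, List.sum_ofFn]
  rfl

lemma exists_eq_ofFn {n : ℕ} {l : List ℕ} (h : l.length = n) : ∃ i : Fin n → ℕ, l = List.ofFn i := by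
  subst h
  exact ⟨l.get, (List.ofFn_get l).symm⟩

lemma pack_eq_iff_exists_strictlyIncreasing (m : ℕ →₀ ℕ) (γ : Comp) :
    pack m = γ ↔
      ∃ l : List ℕ, l.length = γ.length ∧ l.Pairwise (· < ·) ∧ listMon γ l = m := by
  constructor
  · rintro rfl
    obtain ⟨i, hi, hm⟩ := exists_mon m
    exact ⟨List.ofFn i, by simp, List.pairwise_ofFn.mpr fun a b h => hi h,
      by rw [listMon_ofFn, ← hm]⟩
  · rintro ⟨l, hl, hs, rfl⟩
    obtain ⟨i, rfl⟩ := exists_eq_ofFn hl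
    rw [listMon_ofFn, pack_mon]
    exact fun a b h => List.pairwise_ofFn.mp hs h

lemma strictlyIncreasing_listMon_injective {γ : Comp} {l l' : List ℕ} (hl : l.length = γ.length)
    (hl' : l'.length = γ.length) (hs : l.Pairwise (· < ·)) (hs' : l'.Pairwise (· < ·))
    (h : listMon γ l = listMon γ l') : l = l' := by
  obtain ⟨i, rfl⟩ := exists_eq_ofFn hl
  obtain ⟨j, rfl⟩ := exists_eq_ofFn hl'
  rw [listMon_ofFn, listMon_ofFn] at h
  have hij : i = j := mon_injective γ (fun a b h => List.pairwise_ofFn.mp hs h)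
    (fun a b h => List.pairwise_ofFn.mp hs' h) h
  rw [hij]

/-! ### Monomials of weakly monotone index sequences. -/

lemma exists_monotone_extension {n : ℕ} {i : Fin n → ℕ} (hi : Monotone i) :
    ∃ ψ : ℕ → ℕ, Monotone ψ ∧ ∀ j : Fin n, ψ j = i j := by
  rcases Nat.eq_zero_or_pos n with rfl | hn
  · exact ⟨id, monotone_id, fun j => j.elim0⟩
  · refine ⟨fun j => i ⟨min j (n - 1), by omega⟩, fun a b h => hi ?_, fun j => ?_⟩
    · simp only [Fin.mk_le_mk]; omega
    · dsimp only
      congr 1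
      ext
      simp only
      omega

/-- Spells the monomial as a word of `|δ|` letters, the letter at position `t` being the index of
the block of `δ` containing `t`. Equalities of monomials then become equalities of weakly increasing
words, by `eq_of_monotone_of_sum_eq`. The index function lives on all of `ℕ`, whence
`exists_monotone_extension`. -/
lemma mon_eq_sum_level (δ : Comp) (ψ : ℕ → ℕ) : mon δ (fun j => ψ j) =
    ∑ t : Fin (size δ), Finsupp.single (ψ (level δ t)) 1 := by
  have h : mon δ (fun j => ψ j) = (packed δ).mapDomain ψ := by rw [packed, mapDomain_mon]; rfl
  rw [h, ← sum_level, Finsupp.mapDomain_finsetSum,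
    Fin.sum_univ_eq_sum_range (fun j => Finsupp.single (ψ (level δ j)) 1)]
  simp [Finsupp.mapDomain_single]

/-- No block is empty, as the parts of `δ` are positive. -/
lemma exists_level_eq (δ : Comp) (j : Fin δ.length) : ∃ t : Fin (size δ), level δ t = j := by
  have h : (j : ℕ) ∈ (packed δ).support := by
    rw [packed, mon_support δ fun _ _ h => h]
    exact Finset.mem_image_of_mem _ (Finset.mem_univ j)
  rw [← sum_level] at h
  have h1 := Finsupp.support_finsetSum h
  simp only [Finset.mem_biUnion, Finset.mem_range] at h1
  obtain ⟨t, ht, h2⟩ := h1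
  rw [Finsupp.mem_support_single] at h2
  exact ⟨⟨t, ht⟩, h2.1.symm⟩

/-- If `t < s` but the `δ`-level does not grow from `t` to `s`, then no element of `D(δ)`, hence
none of `D(β)`, lies in between. So the `β`-level is a monotone function of the `δ`-level. -/
lemma level_le_of_level_le {β δ : Comp} (h : partialSums β ⊆ partialSums δ) {s t : ℕ}
    (hst : level δ s ≤ level δ t) : level β s ≤ level β t := by
  rcases le_total s t with hle | hle
  · exact level_mono β hle
  · have h1 : (partialSums δ).filter (· ≤ t) = (partialSums δ).filter (· ≤ s) :=
      Finset.eq_of_subset_of_card_le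
        (Finset.monotone_filter_right _ fun _ _ hx => le_trans hx hle) hst
    apply Finset.card_le_card
    intro x hx
    rw [Finset.mem_filter] at hx ⊢
    have h2 : x ∈ (partialSums δ).filter (· ≤ s) := Finset.mem_filter.mpr ⟨h hx.1, hx.2⟩
    rw [← h1] at h2
    exact ⟨hx.1, (Finset.mem_filter.mp h2).2⟩

/-- The weakly increasing word of `m` ascends exactly at `D(pack m)`. It comes from a monotone index
sequence on the blocks of `δ` exactly when it is constant on each block, that is, when all ascents
are at block boundaries. -/
lemma exists_monotone_mon_iff (δ : Comp) (m : ℕ →₀ ℕ) :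
    (∃ i : Fin δ.length → ℕ, Monotone i ∧ mon δ i = m) ↔
      size δ = size (pack m) ∧ partialSums (pack m) ⊆ partialSums δ := by
  obtain ⟨φ, hφ, hm⟩ := exists_mapDomain_packed m
  generalize pack m = β at hm ⊢
  have hm' : m = ∑ t : Fin (size β), Finsupp.single (φ (level β t)) 1 := by
    rw [← mon_eq_sum_level, hm, packed, mapDomain_mon]; rfl
  constructor
  · rintro ⟨i, hi, him⟩
    obtain ⟨ψ, hψ, hi'⟩ := exists_monotone_extension hi
    obtain rfl : (fun j : Fin δ.length => ψ j) = i := funext hi'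
    have hs : size δ = size β := by
      rw [← degree_mon δ (fun j => ψ j), him, hm']
      simp
    refine ⟨hs, fun x hx => ?_⟩
    rw [mon_eq_sum_level, hm', ← hs] at him
    have hw := eq_of_monotone_of_sum_eq (fun a b h => hψ (level_mono δ h))
      (fun a b h => hφ.monotone (level_mono β h)) him
    obtain ⟨h0, h1⟩ := Finset.mem_Ioo.mp (partialSums_subset β hx)
    obtain ⟨y, rfl⟩ : ∃ y, x = y + 1 := ⟨x - 1, by omega⟩
    have h2 : φ (level β y) < φ (level β (y + 1)) := hφ ((level_lt_iff β y).mpr hx)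
    have h3 := congrFun hw ⟨y, by omega⟩
    have h4 := congrFun hw ⟨y + 1, by omega⟩
    simp only at h3 h4
    rw [← h3, ← h4] at h2
    exact (level_lt_iff δ y).mp (hψ.reflect_lt h2)
  · rintro ⟨hs, hsub⟩
    -- The index of block `j` is the letter of the word of `m` at an arbitrary position `t j` in
    -- that block; `level_le_of_level_le` makes the choice immaterial.
    choose t ht using exists_level_eq δ
    have hmono : Monotone fun j => φ (level β (t j)) := fun a b h => by
      apply hφ.monotone
      apply level_le_of_level_le hsub
      rw [ht, ht]
      exact h
    refine ⟨fun j => φ (level β (t j)), hmono, ?_⟩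
    obtain ⟨ψ, hψ, hi'⟩ := exists_monotone_extension hmono
    rw [← funext hi', mon_eq_sum_level, hm', ← hs]
    apply Finset.sum_congr rfl
    intro s _
    congr 1
    have hlt : level δ s < δ.length := by
      have h1 : (packed δ).support = Finset.univ.image (fun j : Fin δ.length => (j : ℕ)) :=
        mon_support δ fun _ _ h => h
      have h2 : level δ s ∈ (packed δ).support := by
        rw [Finsupp.mem_support_iff, ← sum_level, Finsupp.finsetSum_apply]
        apply Nat.ne_of_gt
        apply Finset.sum_pos' (fun _ _ => Nat.zero_le _)
        exact ⟨s, Finset.mem_range.mpr s.2, by simp⟩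
      rw [h1] at h2
      obtain ⟨j, -, hj⟩ := Finset.mem_image.mp h2
      rw [← hj]
      exact j.2
    have h1 := hi' ⟨_, hlt⟩
    simp only at h1
    rw [h1]
    congr 1
    apply le_antisymm <;> apply level_le_of_level_le hsub <;> rw [ht]

/-- Both words are weakly increasing with the same letters, hence equal; each index is read off at
any position of its block. -/
lemma monotone_mon_injective {δ : Comp} {i j : Fin δ.length → ℕ} (hi : Monotone i)
    (hj : Monotone j) (h : mon δ i = mon δ j) : i = j := by
  obtain ⟨ψ, hψ, hi'⟩ := exists_monotone_extension hi
  obtain ⟨χ, hχ, hj'⟩ := exists_monotone_extension hj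
  obtain rfl : (fun a : Fin δ.length => ψ a) = i := funext hi'
  obtain rfl : (fun a : Fin δ.length => χ a) = j := funext hj'
  rw [mon_eq_sum_level, mon_eq_sum_level] at h
  have hw := eq_of_monotone_of_sum_eq (fun a b h => hψ (level_mono δ h))
      (fun a b h => hχ (level_mono δ h)) h
  funext a
  obtain ⟨t, ht⟩ := exists_level_eq δ a
  rw [← ht]
  exact congrFun hw t

lemma exists_weaklyDecreasing_iff (δ : Comp) (m : ℕ →₀ ℕ) :
    (∃ l : List ℕ, l.length = δ.length ∧ l.Pairwise (· ≥ ·) ∧ listMon δ l = m) ↔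
      size δ = size (pack m) ∧ partialSums (pack m) ⊆ partialSums δ.reverse := by
  rw [← size_reverse δ, ← exists_monotone_mon_iff]
  constructor
  · rintro ⟨l, hl, hp, rfl⟩
    have hl' : l.reverse.length = δ.reverse.length := by simp [hl]
    rw [← listMon_reverse hl.symm]
    rw [← List.pairwise_reverse] at hp
    generalize l.reverse = l' at *
    obtain ⟨i, rfl⟩ := exists_eq_ofFn hl'
    exact ⟨i, fun a b h => h.eq_or_lt.elim (fun h => h ▸ le_rfl)
      fun h => List.pairwise_ofFn.mp hp h, (listMon_ofFn _ _).symm⟩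
  · rintro ⟨i, hi, rfl⟩
    refine ⟨(List.ofFn i).reverse, by simp, ?_, ?_⟩
    · rw [List.pairwise_reverse]
      exact List.pairwise_ofFn.mpr fun a b h => hi h.le
    · rw [← listMon_reverse (by simp), List.reverse_reverse, listMon_ofFn]

lemma weaklyDecreasing_listMon_injective {δ : Comp} {l l' : List ℕ} (hl : l.length = δ.length)
    (hl' : l'.length = δ.length) (hp : l.Pairwise (· ≥ ·)) (hp' : l'.Pairwise (· ≥ ·))
    (h : listMon δ l = listMon δ l') : l = l' := by
  rw [← listMon_reverse hl.symm, ← listMon_reverse hl'.symm] at h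
  apply List.reverse_injective
  rw [← List.pairwise_reverse] at hp hp'
  have h1 : l.reverse.length = δ.reverse.length := by simp [hl]
  have h2 : l'.reverse.length = δ.reverse.length := by simp [hl']
  generalize l.reverse = l₁ at *
  generalize l'.reverse = l₂ at *
  obtain ⟨i, rfl⟩ := exists_eq_ofFn h1
  obtain ⟨j, rfl⟩ := exists_eq_ofFn h2
  rw [listMon_ofFn, listMon_ofFn] at h
  rw [monotone_mon_injective _ _ h]
  · exact fun a b h => h.eq_or_lt.elim (fun h => h ▸ le_rfl) fun h => List.pairwise_ofFn.mp hp h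
  · exact fun a b h => h.eq_or_lt.elim (fun h => h ▸ le_rfl) fun h => List.pairwise_ofFn.mp hp' h

/-! ### Signed count of index lists that decrease, then increase. -/

/-- The index lists with monomial `m` whose first `k` entries weakly decrease and whose other
entries strictly increase. -/
def splitLists (γ : Comp) (m : ℕ →₀ ℕ) (k : ℕ) : Set (List ℕ) :=
  {l | l.length = γ.length ∧ listMon γ l = m ∧ (l.take k).Pairwise (· ≥ ·) ∧
    (l.drop k).Pairwise (· < ·)}

/-- The index lists with monomial `m` whose first `k ≥ 1` entries weakly decrease and whose entries
from the `k`-th one on strictly increase. -/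
def valleyLists (γ : Comp) (m : ℕ →₀ ℕ) (k : ℕ) : Set (List ℕ) :=
  {l | l.length = γ.length ∧ listMon γ l = m ∧ (l.take k).Pairwise (· ≥ ·) ∧
    (l.drop (k - 1)).Pairwise (· < ·) ∧ 1 ≤ k ∧ k ≤ γ.length}

/-- Reduces monotonicity to adjacent entries, so that moving the cut by one place changes a single
comparison. -/
lemma pairwise_take_iff (l : List ℕ) (k : ℕ) : (l.take k).Pairwise (· ≥ ·) ↔
    ∀ a, a + 1 < k → ∀ h : a + 1 < l.length, l[a + 1] ≤ l[a] := by
  rw [← List.isChain_iff_pairwise, List.isChain_iff_getElem]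
  simp only [List.length_take, List.getElem_take, ge_iff_le]
  exact ⟨fun h a ha hl => h a (by omega), fun h a ha => h a (by omega) (by omega)⟩

lemma pairwise_drop_iff (l : List ℕ) (k : ℕ) : (l.drop k).Pairwise (· < ·) ↔
    ∀ a, k ≤ a → ∀ h : a + 1 < l.length, l[a] < l[a + 1] := by
  rw [← List.isChain_iff_pairwise, List.isChain_iff_getElem]
  simp only [List.length_drop, List.getElem_drop]
  constructor
  · intro h a ha hl
    obtain ⟨b, rfl⟩ := Nat.exists_eq_add_of_le ha
    exact h b (by omega)
  · intro h a ha
    exact h (k + a) (by omega) (by omega)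

lemma splitLists_eq_union {γ : Comp} (hγ : γ ≠ []) (m : ℕ →₀ ℕ) {k : ℕ} (hk : k ≤ γ.length) :
    splitLists γ m k = valleyLists γ m k ∪ valleyLists γ m (k + 1) := by
  have hpos := List.length_pos_iff.mpr hγ
  ext l
  simp only [splitLists, valleyLists, Set.mem_union, Set.mem_ofPred_eq, pairwise_take_iff,
    pairwise_drop_iff]
  constructor
  · rintro ⟨hl, hm, h1, h2⟩
    rcases Nat.eq_zero_or_pos k with rfl | hk0
    · exact Or.inr ⟨hl, hm, fun a ha => by omega, fun a ha h => h2 a (by omega) h, by omega,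
        by omega⟩
    · by_cases hlt : k < γ.length
      · rcases Nat.lt_or_ge (l[k - 1]'(by omega)) (l[k - 1 + 1]'(by omega)) with h | h
        · refine Or.inl ⟨hl, hm, h1, fun a ha h' => ?_, by omega, by omega⟩
          rcases ha.eq_or_lt with rfl | ha
          · exact h
          · exact h2 a (by omega) h'
        · refine Or.inr ⟨hl, hm, fun a ha h' => ?_, fun a ha h => h2 a (by omega) h, by omega,
            by omega⟩
          by_cases hak : a = k - 1
          · subst hak; exact h
          · exact h1 a (by omega) h'
      · exact Or.inl ⟨hl, hm, h1, fun a ha h => by omega, by omega, by omega⟩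
  · rintro (⟨hl, hm, h1, h2, -⟩ | ⟨hl, hm, h1, h2, -⟩)
    · exact ⟨hl, hm, h1, fun a ha h => h2 a (by omega) h⟩
    · exact ⟨hl, hm, fun a ha h => h1 a (by omega) h, fun a ha h => h2 a (by omega) h⟩

lemma disjoint_valleyLists (γ : Comp) (m : ℕ →₀ ℕ) (k : ℕ) :
    Disjoint (valleyLists γ m k) (valleyLists γ m (k + 1)) := by
  rw [Set.disjoint_left]
  simp only [valleyLists, Set.mem_ofPred_eq, pairwise_take_iff, pairwise_drop_iff]
  rintro l ⟨hl, -, h1, h2, h3, h4⟩ ⟨-, -, h5, h6, h7, h8⟩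
  have := h2 (k - 1) le_rfl (by omega)
  have := h5 (k - 1) (by omega) (by omega)
  omega

/-- An index list in `splitLists` is given by the monomials of its two parts. -/
lemma bijOn_splitLists (γ : Comp) (m : ℕ →₀ ℕ) {k : ℕ} (hk : k ≤ γ.length) :
    Set.BijOn (fun l => (listMon (γ.take k) (l.take k), listMon (γ.drop k) (l.drop k)))
      (splitLists γ m k)
      {p | p ∈ Finset.HasAntidiagonal.antidiagonal m ∧
        (size (γ.take k) = size (pack p.1) ∧
          partialSums (pack p.1) ⊆ partialSums (γ.take k).reverse) ∧ pack p.2 = γ.drop k} := by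
  have hmon : ∀ l : List ℕ, l.length = γ.length → listMon γ l =
      listMon (γ.take k) (l.take k) + listMon (γ.drop k) (l.drop k) := by
    intro l hl
    rw [← listMon_append (by simp [hl]), List.take_append_drop, List.take_append_drop]
  refine ⟨?_, ?_, ?_⟩
  · rintro l ⟨hl, hm, h1, h2⟩
    refine ⟨?_, ?_, ?_⟩
    · rw [Finset.HasAntidiagonal.mem_antidiagonal, ← hm, hmon l hl]
    · exact (exists_weaklyDecreasing_iff _ _).mp ⟨_, by simp [hl], h1, rfl⟩
    · exact (pack_eq_iff_exists_strictlyIncreasing _ _).mpr ⟨_, by simp [hl], h2, rfl⟩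
  · rintro l ⟨hl, hm, h1, h2⟩ l' ⟨hl', hm', h1', h2'⟩ h
    rw [← List.take_append_drop k l, ← List.take_append_drop k l',
      weaklyDecreasing_listMon_injective (by simp [hl]) (by simp [hl']) h1 h1'
        (congrArg Prod.fst h),
      strictlyIncreasing_listMon_injective (by simp [hl]) (by simp [hl']) h2 h2'
        (congrArg Prod.snd h)]
  · rintro ⟨a, b⟩ ⟨hab, ha, hb⟩
    rw [Finset.HasAntidiagonal.mem_antidiagonal] at hab
    obtain ⟨l, hl, hp, rfl⟩ := (exists_weaklyDecreasing_iff _ _).mpr ha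
    obtain ⟨l', hl', hp', rfl⟩ := (pack_eq_iff_exists_strictlyIncreasing _ _).mp hb
    have hlk : l.length = k := by rw [hl]; simp [hk]
    have ht : (l ++ l').take k = l := by rw [← hlk]; simp
    have hd : (l ++ l').drop k = l' := by rw [← hlk]; simp
    have hlen : (l ++ l').length = γ.length := by
      rw [List.length_append, hl', hlk, List.length_drop]; omega
    refine ⟨l ++ l', ⟨hlen, ?_, by rwa [ht], by rwa [hd]⟩, ?_⟩
    · rw [hmon _ hlen, ht, hd]; exact hab
    · simp only [ht, hd]

lemma finite_splitLists (γ : Comp) (m : ℕ →₀ ℕ) {k : ℕ} (hk : k ≤ γ.length) :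
    (splitLists γ m k).Finite := by
  refine Set.Finite.of_finite_image ?_ (bijOn_splitLists γ m hk).injOn
  rw [(bijOn_splitLists γ m hk).image_eq]
  exact (Finset.finite_toSet (Finset.HasAntidiagonal.antidiagonal m)).subset fun p hp => hp.1

/-- With `V k` the number of `valleyLists`, the `k`-th count is `V k + V (k + 1)`, so the
alternating sum telescopes; the range condition `1 ≤ k ≤ γ.length` kills both end terms. -/
lemma sum_neg_one_pow_mul_ncard_splitLists {R : Type*} [CommRing R] {γ : Comp} (hγ : γ ≠ [])
    (m : ℕ →₀ ℕ) : ∑ k ∈ Finset.range (γ.length + 1),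
      (-1 : R) ^ k * ((splitLists γ m k).ncard : R) = 0 := by
  have h1 : ∀ k ∈ Finset.range (γ.length + 1),
      (-1 : R) ^ k * ((splitLists γ m k).ncard : R) =
        (-1) ^ k * ((valleyLists γ m k).ncard : R) -
          (-1) ^ (k + 1) * ((valleyLists γ m (k + 1)).ncard : R) := by
    intro k hk
    have hk' : k ≤ γ.length := Nat.lt_succ_iff.mp (Finset.mem_range.mp hk)
    have hf := finite_splitLists γ m hk'
    rw [splitLists_eq_union hγ m hk'] at hf ⊢
    rw [Set.ncard_union_eq (disjoint_valleyLists γ m k) (hf.subset Set.subset_union_left)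
      (hf.subset Set.subset_union_right)]
    push_cast
    ring
  have h2 : valleyLists γ m 0 = ∅ := by
    ext l; simp [valleyLists]
  have h3 : valleyLists γ m (γ.length + 1) = ∅ := by
    ext l; simp [valleyLists]
  rw [Finset.sum_congr rfl h1, Finset.sum_range_sub', h2, h3]
  simp

/-! ### Reversal, `ω` and signs. -/

lemma mem_partialSums_reverse {α : Comp} {x : ℕ} :
    x ∈ partialSums α.reverse ↔ x ∈ Finset.Ioo 0 (size α) ∧ size α - x ∈ partialSums α := by
  have key : ∀ (β : Comp) (y : ℕ), y ∈ partialSums β → size β - y ∈ partialSums β.reverse := by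
    intro β y hy
    simp only [partialSums, Finset.mem_image, Finset.mem_Ioo] at hy ⊢
    obtain ⟨i, ⟨h0, h1⟩, rfl⟩ := hy
    refine ⟨β.length - i, ⟨by omega, by rw [List.length_reverse]; omega⟩, ?_⟩
    have h2 : size β = size (β.take i) + size (β.drop i) := by
      rw [← size_append, List.take_append_drop]
    rw [List.take_reverse, size_reverse, h2, Nat.sub_sub_self h1.le]
    omega
  constructor
  · intro h
    have h1 := partialSums_subset _ h
    have h2 := key _ _ h
    rw [size_reverse] at h1 h2
    rw [List.reverse_reverse] at h2
    exact ⟨h1, h2⟩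
  · rintro ⟨h1, h2⟩
    have h3 := key _ _ h2
    rw [Finset.mem_Ioo] at h1
    rwa [Nat.sub_sub_self h1.2.le] at h3

lemma partialSums_reverse (α : Comp) :
    partialSums α.reverse = (partialSums α).image (size α - ·) := by
  ext x
  rw [mem_partialSums_reverse, Finset.mem_image]
  constructor
  · rintro ⟨h1, h2⟩
    rw [Finset.mem_Ioo] at h1
    exact ⟨_, h2, by omega⟩
  · rintro ⟨y, hy, rfl⟩
    have h1 := Finset.mem_Ioo.mp (partialSums_subset _ hy)
    refine ⟨Finset.mem_Ioo.mpr (by omega), ?_⟩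
    rwa [Nat.sub_sub_self h1.2.le]

lemma card_partialSums_reverse (α : Comp) :
    (partialSums α.reverse).card = (partialSums α).card := by
  rw [partialSums_reverse, Finset.card_image_of_injOn]
  intro x hx y hy h
  have h1 := Finset.mem_Ioo.mp (partialSums_subset _ hx)
  have h2 := Finset.mem_Ioo.mp (partialSums_subset _ hy)
  simp only at h
  omega

lemma card_partialSums {α : Comp} (h : α ≠ []) : (partialSums α).card + 1 = α.length := by
  rcases List.eq_nil_or_concat α with rfl | ⟨β, b, rfl⟩
  · exact absurd rfl h
  · rw [List.concat_eq_append, card_partialSums_concat]; simp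

/-- `D(ω(α))` is the complement of `D(rev α)`; the reflection `x ↦ n - x` moves the reversal from
`α` to `δ`. -/
lemma subset_partialSums_omega_iff {α δ : Comp} (h : size α = size δ) :
    partialSums δ ⊆ partialSums (omega α) ↔
      Disjoint (partialSums α) (partialSums δ.reverse) := by
  rw [(omega_spec α).2, Finset.disjoint_left]
  constructor
  · intro hs x hx hx'
    rw [mem_partialSums_reverse] at hx'
    have h1 := Finset.mem_sdiff.mp (hs hx'.2)
    apply h1.2
    rw [mem_partialSums_reverse]
    have h2 := Finset.mem_Ioo.mp hx'.1
    refine ⟨h1.1, ?_⟩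
    rwa [h, Nat.sub_sub_self h2.2.le]
  · intro hd x hx
    have h1 := partialSums_subset _ hx
    rw [Finset.mem_sdiff, h]
    refine ⟨h1, fun hx' => ?_⟩
    rw [mem_partialSums_reverse, h] at hx'
    apply hd hx'.2
    rw [Finset.mem_Ioo] at h1
    rw [mem_partialSums_reverse, Nat.sub_sub_self h1.2.le]
    exact ⟨Finset.mem_Ioo.mpr (by omega), hx⟩

/-- The sign with which `M_δ` occurs when paired with `R_{ω(α)}`. -/
lemma neg_one_pow_card_omega {R : Type*} [CommRing R] {α δ : Comp} (h : size α = size δ)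
    (hd : partialSums δ ⊆ partialSums (omega α)) :
    (-1 : R) ^ size α * (-1) ^ (partialSums (omega α) \ partialSums δ).card =
      (-1) ^ δ.length * (-1) ^ (partialSums α).card := by
  have h1 := Finset.card_sdiff_add_card_eq_card hd
  have h2 : (partialSums (omega α)).card + (partialSums α).card = size α - 1 := by
    rw [(omega_spec α).2, ← card_partialSums_reverse α]
    have h3 : partialSums α.reverse ⊆ Finset.Ioo 0 (size α) := by
      simpa using partialSums_subset α.reverse
    rw [Finset.card_sdiff_add_card_eq_card h3, Nat.card_Ioo, Nat.sub_zero]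
  rw [← pow_add, ← pow_add]
  -- In size `0` the truncated `size α - 1` is `0`, so this case is separate.
  by_cases hδ : δ = []
  · subst hδ
    have h3 : α = [] := size_eq_zero.mp h
    subst h3
    simp only [size_nil, partialSums_nil] at *
    congr 1
    simp only [List.length_nil, Finset.card_empty] at *
    omega
  · have h3 := card_partialSums hδ
    have h4 : size δ ≠ 0 := fun h' => hδ (size_eq_zero.mp h')
    -- With `n = |α|`, the left exponent is `n + (n - 1 - |D(α)|) - (ℓ(δ) - 1)`, which has the
    -- parity of `ℓ(δ) + |D(α)|`.
    rw [neg_one_pow_eq_pow_mod_two, neg_one_pow_eq_pow_mod_two (n := δ.length + _)]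
    congr 1
    omega

lemma sum_compsOfSize {A : Type*} [AddCommMonoid A] (n : ℕ) (g : Finset ℕ → A) :
    ∑ α ∈ compsOfSize n, g (partialSums α) = ∑ T ∈ (Finset.Ioo 0 n).powerset, g T := by
  apply Finset.sum_bij (fun α _ => partialSums α)
  · intro α hα
    rw [mem_compsOfSize] at hα
    rw [Finset.mem_powerset, ← hα]
    exact partialSums_subset α
  · intro α hα β hβ h
    rw [mem_compsOfSize] at hα hβ
    exact comp_ext (hα.trans hβ.symm) h
  · intro T hT
    obtain ⟨α, h1, h2⟩ := exists_comp n T (Finset.mem_powerset.mp hT)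
    exact ⟨α, mem_compsOfSize.mpr h1, h2⟩
  · intro α _
    rfl

variable (k : Type*) [CommRing k]

/-! ### The antipode on the monomial basis. -/

lemma pairing_ribbon_monomialBasis (β δ : Comp) :
    pairing k (ribbon k β) (monomialBasis k δ) =
      if size δ = size β ∧ partialSums δ ⊆ partialSums β then
        (-1) ^ (partialSums β \ partialSums δ).card else 0 := by
  rw [ribbon, map_sum, LinearMap.sum_apply]
  simp only [map_smul, LinearMap.smul_apply, pairing_complete_monomial, smul_eq_mul, mul_ite,
    mul_one, mul_zero, Finset.sum_ite_eq', Finset.mem_filter, mem_compsOfSize]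

/-- The image of `M_δ` under the antipode of `QSym`, written in the fundamental basis. -/
noncomputable def antipodeMonomial (δ : Comp) : QSym k :=
  ∑ α ∈ compsOfSize (size δ),
    ((-1) ^ size α * pairing k (ribbon k (omega α)) (monomialBasis k δ)) • fundamental k α

lemma coeff_antipodeMonomial (δ : Comp) (m : ℕ →₀ ℕ) :
    MvPowerSeries.coeff m (antipodeMonomial k δ : MvPowerSeries ℕ k) =
      if size δ = size (pack m) ∧ partialSums (pack m) ⊆ partialSums δ.reverse then
        (-1) ^ δ.length else 0 := by
  have h1 : MvPowerSeries.coeff m (antipodeMonomial k δ : MvPowerSeries ℕ k) =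
      ∑ α ∈ compsOfSize (size δ),
        (if Disjoint (partialSums α) (partialSums δ.reverse) then
          (-1 : k) ^ δ.length * (-1) ^ (partialSums α).card else 0) *
        if size δ = size (pack m) ∧ partialSums α ⊆ partialSums (pack m) then 1 else 0 := by
    rw [antipodeMonomial, AddSubmonoidClass.coe_finsetSum, map_sum]
    apply Finset.sum_congr rfl
    intro α hα
    rw [mem_compsOfSize] at hα
    change MvPowerSeries.coeff m (_ • fundamentalSeries k α) = _
    rw [map_smul, smul_eq_mul, coeff_fundamentalSeries, hα, pairing_ribbon_monomialBasis,
      (omega_spec α).1]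
    congr 1
    simp only [hα, true_and]
    have hd := subset_partialSums_omega_iff hα
    by_cases h : Disjoint (partialSums α) (partialSums δ.reverse)
    · rw [if_pos h, if_pos (hd.mpr h), ← hα, neg_one_pow_card_omega hα (hd.mpr h)]
    · rw [if_neg h, if_neg (mt hd.mp h), mul_zero]
  rw [h1, sum_compsOfSize (size δ) (fun T =>
    (if Disjoint T (partialSums δ.reverse) then (-1 : k) ^ δ.length * (-1) ^ T.card else 0) *
        if size δ = size (pack m) ∧ T ⊆ partialSums (pack m) then 1 else 0)]
  by_cases hs : size δ = size (pack m)
  · simp only [hs, true_and, mul_ite, mul_one, mul_zero]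
    rw [← Finset.sum_filter, ← Finset.sum_filter, Finset.filter_filter]
    -- The ribbon forces `T = D(α)` to avoid `D(rev δ)`, the fundamental forces it into `D(pack m)`.
    -- The alternating sum over the subsets of the difference is `0` unless that difference is
    -- empty.
    have h2 : (Finset.Ioo 0 (size (pack m))).powerset.filter
        (fun T => T ⊆ partialSums (pack m) ∧ Disjoint T (partialSums δ.reverse)) =
        (partialSums (pack m) \ partialSums δ.reverse).powerset := by
      ext T
      simp only [Finset.mem_filter, Finset.mem_powerset, Finset.subset_sdiff]
      exact ⟨fun h => h.2, fun h => ⟨h.1.trans (partialSums_subset _), h⟩⟩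
    have h3 := congrArg (Int.cast : ℤ → k) (Finset.sum_powerset_neg_one_pow_card
      (x := partialSums (pack m) \ partialSums δ.reverse))
    push_cast at h3
    rw [h2, ← Finset.mul_sum, h3]
    simp [Finset.sdiff_eq_empty_iff_subset]
  · simp [hs]

/-! ### The sum over `α` and the antipode axiom. -/

/-- The truncation at `|α| ≤ N` of `∑_α (-1)^{|α|} F_α R_{ω(α)}^⊥`. -/
noncomputable def truncatedSum (N : ℕ) : QSym k →ₗ[k] QSym k :=
  ∑ α ∈ (finite_size_le N).toFinset,
    LinearMap.mulLeft k ((-1) ^ size α * fundamental k α) ∘ₗ perp k (ribbon k (omega α))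

lemma perp_monomialBasis (g : NSym k) (γ : Comp) : perp k g (monomialBasis k γ) =
    ∑ i ∈ Finset.range (γ.length + 1),
      pairing k g (monomialBasis k (γ.take i)) • monomialBasis k (γ.drop i) := by
  rw [perp, LinearMap.comp_apply, LinearMap.comp_apply, comul, Module.Basis.constr_basis, map_sum,
    map_sum]
  simp

lemma size_take_le (γ : Comp) (i : ℕ) : size (γ.take i) ≤ size γ := by
  conv_rhs => rw [← List.take_append_drop i γ, size_append]
  exact Nat.le_add_right _ _

lemma perp_ribbon_monomialBasis_eq_zero {α γ : Comp} (h : size γ < size α) :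
    perp k (ribbon k (omega α)) (monomialBasis k γ) = 0 := by
  rw [perp_monomialBasis]
  apply Finset.sum_eq_zero
  intro i _
  rw [pairing_ribbon_monomialBasis, if_neg, zero_smul]
  rintro ⟨h1, -⟩
  rw [(omega_spec α).1] at h1
  have := size_take_le γ i
  omega

/-- For fixed `i` only `α` of size `|γ₁…γ_i|` pair nontrivially, and `N ≥ |γ|` ensures that the
truncation contains them all. -/
lemma truncatedSum_monomialBasis {N : ℕ} {γ : Comp} (h : size γ ≤ N) :
    truncatedSum k N (monomialBasis k γ) =
      ∑ i ∈ Finset.range (γ.length + 1),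
        antipodeMonomial k (γ.take i) * monomialBasis k (γ.drop i) := by
  rw [truncatedSum, LinearMap.sum_apply]
  simp only [LinearMap.comp_apply, perp_monomialBasis, map_sum, map_smul, LinearMap.mulLeft_apply]
  rw [Finset.sum_comm]
  apply Finset.sum_congr rfl
  intro i _
  rw [antipodeMonomial, Finset.sum_mul]
  symm
  have hi := size_take_le γ i
  have hsub : compsOfSize (size (γ.take i)) ⊆ (finite_size_le N).toFinset := by
    intro α hα
    rw [mem_compsOfSize] at hα
    simp only [Set.Finite.mem_toFinset, Set.mem_ofPred_eq]
    omega
  rw [← Finset.sum_subset hsub]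
  · apply Finset.sum_congr rfl
    intro α _
    rw [mul_smul, smul_mul_assoc, smul_mul_assoc, smul_comm, mul_assoc]
    rw [Algebra.smul_def ((-1 : k) ^ size α), map_pow, map_neg, map_one]
  · intro α _ hα
    rw [mem_compsOfSize] at hα
    rw [pairing_ribbon_monomialBasis, if_neg, zero_smul]
    rintro ⟨h1, -⟩
    rw [(omega_spec α).1] at h1
    exact hα h1.symm

/-- The antipode axiom, on the monomial basis. -/
lemma sum_antipodeMonomial_mul (γ : Comp) :
    ∑ i ∈ Finset.range (γ.length + 1),
        antipodeMonomial k (γ.take i) * monomialBasis k (γ.drop i) =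
      algebraMap k (QSym k) (counit k (monomialBasis k γ)) := by
  classical
  apply Subtype.ext
  ext m
  have h1 : ∀ i ∈ Finset.range (γ.length + 1),
      MvPowerSeries.coeff m ((antipodeMonomial k (γ.take i) * monomialBasis k (γ.drop i) : QSym k) :
        MvPowerSeries ℕ k) = (-1) ^ i * ((splitLists γ m i).ncard : k) := by
    intro i hi
    have hi' : i ≤ γ.length := Nat.lt_succ_iff.mp (Finset.mem_range.mp hi)
    change MvPowerSeries.coeff m ((antipodeMonomial k (γ.take i) : MvPowerSeries ℕ k) *
      (monomialBasis k (γ.drop i) : MvPowerSeries ℕ k)) = _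
    rw [MvPowerSeries.coeff_mul]
    have hlen : (γ.take i).length = i := by simp [hi']
    simp only [coeff_antipodeMonomial, coe_monomialBasis, coeff_monomialSeries, hlen, mul_ite,
      mul_one, mul_zero, ← ite_and]
    -- All nonzero terms equal `(-1) ^ i`, so it remains to count the factorizations of `m`, which
    -- `bijOn_splitLists` matches with index lists.
    rw [← Finset.sum_filter, Finset.sum_const, nsmul_eq_mul, mul_comm]
    have hb := bijOn_splitLists γ m hi'
    rw [← hb.injOn.ncard_image, hb.image_eq, ← Set.ncard_coe_finset]
    simp [and_comm]
  rw [AddSubmonoidClass.coe_finsetSum, map_sum, Finset.sum_congr rfl h1]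
  change _ = MvPowerSeries.coeff m (algebraMap k (MvPowerSeries ℕ k) _)
  rw [counit, Module.Basis.constr_basis, MvPowerSeries.algebraMap_apply, MvPowerSeries.coeff_C]
  by_cases hγ : γ = []
  · subst hγ
    -- For `γ = ∅` nothing cancels: the empty list gives the constant `1`.
    have h2 : splitLists [] m 0 = if m = 0 then {[]} else ∅ := by
      ext l
      split_ifs with hm
      · subst hm
        simp only [splitLists, Set.mem_ofPred_eq, List.length_nil, List.length_eq_zero_iff,
          Set.mem_singleton_iff]
        exact ⟨fun h => h.1, fun h => by subst h; simp [listMon]⟩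
      · simp only [splitLists, Set.mem_ofPred_eq, Set.mem_empty_iff_false, iff_false]
        rintro ⟨-, h, -⟩
        exact hm (by rw [← h]; rfl)
    rw [List.length_nil, zero_add, Finset.sum_range_one, h2]
    by_cases hm : m = 0 <;> simp [hm]
  · rw [sum_neg_one_pow_mul_ncard_splitLists hγ, if_neg hγ]
    simp

/-- Asserted for all large `N`, so that the bounds of two summands can be merged in the induction
over the span of the `M_γ`. -/
lemma exists_truncatedSum_eq (f : QSym k) : ∃ N₀, ∀ N ≥ N₀,
    (∀ α, N < size α → perp k (ribbon k (omega α)) f = 0) ∧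
      truncatedSum k N f = algebraMap k (QSym k) (counit k f) := by
  have hf : f ∈ Submodule.span k (Set.range (monomialBasis k)) := by
    rw [(monomialBasis k).span_eq]; trivial
  induction hf using Submodule.span_induction with
  | mem x hx =>
    obtain ⟨γ, rfl⟩ := hx
    refine ⟨size γ, fun N hN => ⟨fun α hα => ?_, ?_⟩⟩
    · exact perp_ribbon_monomialBasis_eq_zero k (by omega)
    · rw [truncatedSum_monomialBasis k hN, sum_antipodeMonomial_mul]
  | zero => exact ⟨0, fun N _ => ⟨fun α _ => map_zero _, by simp⟩⟩
  | add x y _ _ hx hy =>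
    obtain ⟨N₁, h₁⟩ := hx
    obtain ⟨N₂, h₂⟩ := hy
    refine ⟨max N₁ N₂, fun N hN => ⟨fun α hα => ?_, ?_⟩⟩
    · rw [map_add, (h₁ N (by omega)).1 α hα, (h₂ N (by omega)).1 α hα, add_zero]
    · rw [map_add, (h₁ N (by omega)).2, (h₂ N (by omega)).2, map_add, map_add]
  | smul r x _ hx =>
    obtain ⟨N₁, h₁⟩ := hx
    refine ⟨N₁, fun N hN => ⟨fun α hα => ?_, ?_⟩⟩
    · rw [map_smul, (h₁ N hN).1 α hα, smul_zero]
    · rw [map_smul, (h₁ N hN).2, map_smul, smul_eq_mul, map_mul, Algebra.smul_def]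

end QuasiSym

/-- `ε(f) = ∑_α (-1)^{|α|} F_α R_{ω(α)}^⊥ f` -/
theorem mainTheorem9 (k : Type*) [CommRing k] (f : QuasiSym.QSym k) :
    {α : QuasiSym.Comp |
      QuasiSym.perp k (QuasiSym.ribbon k (QuasiSym.omega α)) f ≠ 0}.Finite ∧
    algebraMap k (QuasiSym.QSym k) (QuasiSym.counit k f) =
      ∑ᶠ α : QuasiSym.Comp, (-1) ^ QuasiSym.size α * QuasiSym.fundamental k α *
        QuasiSym.perp k (QuasiSym.ribbon k (QuasiSym.omega α)) f := by
  obtain ⟨N, hN⟩ := QuasiSym.exists_truncatedSum_eq k f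
  obtain ⟨h1, h2⟩ := hN N le_rfl
  constructor
  · apply (QuasiSym.finite_size_le N).subset
    intro α hα
    by_contra h
    exact hα (h1 α (not_le.mp h))
  -- All terms with `|α| > N` vanish, so the `finsum` has finite support and is the truncated sum.
  · rw [← h2, finsum_eq_sum_of_support_subset (s := (QuasiSym.finite_size_le N).toFinset),
      QuasiSym.truncatedSum, LinearMap.sum_apply]
    · rfl
    · intro α hα
      rw [Set.Finite.coe_toFinset]
      by_contra h
      apply hα
      simp only
      rw [h1 α (not_le.mp h), mul_zero]
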